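/- Let $p$ be a prime and let $\mathbb{F}$ be an algebraically closed field (of any characteristic). Let $A\subset\mathbb{F}_p$ be non-empty. For $f$ in the group algebra $\mathbb{F}[\mathbb{F}_p]$ of the additive group $\mathbb{F}_p$, let $T_f:\mathbb{F}[\mathbb{F}_p]\to\mathbb{F}[\mathbb{F}_p]$ be the multiplication operator $T_fg=fg$, and let $$u_{\mathbb{F}}(A)=\min\{\operatorname{rk}T_f:\ \emptyset\neq\operatorname{supp}(f)\subset A\}.$$ For $k\ge 1$ let $X_{A,k}$ be the simplicial complex on $\mathbb{F}_p$ whose faces are all non-empty $\sigma\subset\mathbb{F}_p$ with $|\sigma|<k$, together with all $\sigma\subset\mathbb{F}_p$ with $|\sigma|=k$ and $\sum_{x\in\sigma}x\in A$. Let $H_n(\,\cdot\,;\mathbb{F})$ denote ordinary (unreduced) simplicial homology. (a) If $|A|\ge 3$, then the set $\{k:\ 1<k<p,\ H_{k-1}(X_{A,k};\mathbb{F})\neq 0\}$ is non-empty and $$u_{\mathbb{F}}(A)=p-\max\{k:\ 1<k<p,\ H_{k-1}(X_{A,k};\mathbb{F})\neq 0\}.$$ (b) If $|A|\ge 2$,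 then the set $\{k:\ 1\le k<p,\ H_{k-1}(X_{A,k};\mathbb{F})\neq 0\}$ is non-empty and $$u_{\mathbb{F}}(A)=p-\max\{k:\ 1\le k<p,\ H_{k-1}(X_{A,k};\mathbb{F})\neq 0\}.$$ (c) If $|A|=1$, then $H_{k-1}(X_{A,k};\mathbb{F})=0$ for all $1<k<p$, and $u_{\mathbb{F}}(A)=p$. -/

import Mathlib

noncomputable section

namespace SumComplex

section Homology

variable {V : Type*} [Fintype V] [DecidableEq V]

/-- The space `C_n(X; F)` of simplicial `n`-chains of the simplicial complex `X` (on a finite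
vertex set `V`) with coefficients in `F`, in the form of skew-symmetric functions: the value of
such a function at an ordered tuple `(v 0, ..., v n)` of vertices is the coefficient of the
oriented simplex `[v 0, ..., v n]`. It changes by the sign of a permutation of the tuple, and
vanishes if the tuple has a repetition or does not span a face of `X`. -/
def chains (X : PreAbstractSimplicialComplex V) (F : Type*) [Field F] (n : ℕ) :
    Submodule F ((Fin (n + 1) → V) → F) where
  carrier := {φ |
    (∀ (σ : Equiv.Perm (Fin (n + 1))) (v : Fin (n + 1) → V),
      φ (v ∘ σ) = ((Equiv.Perm.sign σ : ℤ) : F) * φ v) ∧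
    (∀ v : Fin (n + 1) → V, φ v ≠ 0 →
      Function.Injective v ∧ Finset.univ.image v ∈ X.faces)}
  zero_mem' := ⟨fun _ _ => by simp, fun _ h => absurd rfl h⟩
  add_mem' := by
    rintro φ ψ ⟨h₁, h₂⟩ ⟨h₃, h₄⟩
    refine ⟨fun σ v => ?_, fun v hv => ?_⟩
    · simp only [Pi.add_apply, h₁ σ v, h₃ σ v, mul_add]
    · by_cases h : φ v = 0
      · exact h₄ v fun h' => hv (by simp [h, h'])
      · exact h₂ v h
  smul_mem' := by
    rintro c φ ⟨h₁, h₂⟩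
    refine ⟨fun σ v => ?_, fun v hv => h₂ v fun h => hv (by simp [h])⟩
    simp only [Pi.smul_apply, smul_eq_mul, h₁ σ v]
    ring

/-- The boundary map `∂ : C_{n+1} → C_n`, defined on all functions of vertex tuples. The
coefficient of `[v 0, ..., v n]` in `∂ φ` is the sum over all vertices `x` of the coefficient of
`[x, v 0, ..., v n]` in `φ`, so that on chains
`∂ [v 0, ..., v (n+1)] = ∑ i, (-1) ^ i [v 0, ..., omit v i, ..., v (n+1)]`. -/
def boundary (V : Type*) [Fintype V] (F : Type*) [Field F] (n : ℕ) :
    ((Fin (n + 2) → V) → F) →ₗ[F] ((Fin (n + 1) → V) → F) where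
  toFun φ v := ∑ x : V, φ (Fin.cons x v)
  map_add' φ ψ := by
    ext v
    simp [Finset.sum_add_distrib]
  map_smul' c φ := by
    ext v
    simp [Finset.mul_sum]

/-- The boundary map takes chains of `X` to chains of `X`. -/
theorem boundary_mem (X : PreAbstractSimplicialComplex V) (F : Type*) [Field F] (n : ℕ)
    {φ : (Fin (n + 2) → V) → F} (hφ : φ ∈ chains X F (n + 1)) :
    boundary V F n φ ∈ chains X F n := by
  obtain ⟨h₁, h₂⟩ := hφ
  refine ⟨fun σ v => ?_, fun v hv => ?_⟩
  · change ∑ x : V, φ (Fin.cons x (v ∘ σ)) = _ * ∑ x : V, φ (Fin.cons x v)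
    rw [Finset.mul_sum]
    refine Finset.sum_congr rfl fun x _ => ?_
    have h := h₁ (Equiv.Perm.decomposeFin.symm (0, σ)) (Fin.cons x v)
    rw [Equiv.Perm.decomposeFin.symm_sign] at h
    simp only [if_true, one_mul] at h
    rw [← h]
    congr 1
    funext i
    refine Fin.cases ?_ (fun j => ?_) i
    · simp
    · simp
  · obtain ⟨x, -, hx⟩ := Finset.exists_ne_zero_of_sum_ne_zero hv
    obtain ⟨hi, hf⟩ := h₂ _ hx
    refine ⟨fun i j hij => ?_, ?_⟩
    · exact Fin.succ_injective _ (hi (by simpa using hij))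
    · refine (X.isRelLowerSet_faces hf).2 ?_ (Finset.univ_nonempty.image v)
      intro y hy
      obtain ⟨i, -, rfl⟩ := Finset.mem_image.1 hy
      exact Finset.mem_image.2 ⟨i.succ, Finset.mem_univ _, by simp⟩

/-- The space `Z_n(X; F)` of `n`-cycles: the `n`-chains with zero boundary; every `0`-chain is
a cycle. -/
def cycles (X : PreAbstractSimplicialComplex V) (F : Type*) [Field F] :
    (n : ℕ) → Submodule F ((Fin (n + 1) → V) → F)
  | 0 => chains X F 0
  | n + 1 => chains X F (n + 1) ⊓ LinearMap.ker (boundary V F n)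

/-- The space `B_n(X; F)` of `n`-boundaries: the boundaries of the `(n+1)`-chains of `X`. -/
def boundaries (X : PreAbstractSimplicialComplex V) (F : Type*) [Field F] (n : ℕ) :
    Submodule F ((Fin (n + 1) → V) → F) :=
  (chains X F (n + 1)).map (boundary V F n)

/-- The `n`-th (unreduced) simplicial homology `H_n(X; F)`: cycles modulo boundaries. -/
abbrev Homology (X : PreAbstractSimplicialComplex V) (F : Type*) [Field F] (n : ℕ) : Type _ :=
  cycles X F n ⧸ (boundaries X F n).submoduleOf (cycles X F n)

/-- Boundaries are cycles. -/
theorem boundaries_le_cycles (X : PreAbstractSimplicialComplex V) (F : Type*) [Field F] (n : ℕ) :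
    boundaries X F n ≤ cycles X F n := by
  cases n with
  | zero =>
    rintro _ ⟨φ, hφ, rfl⟩
    exact boundary_mem X F 0 hφ
  | succ n =>
    rintro _ ⟨φ, hφ, rfl⟩
    refine ⟨boundary_mem X F (n + 1) hφ, ?_⟩
    obtain ⟨h₁, h₂⟩ := hφ
    change boundary V F n _ = 0
    ext v
    change ∑ x : V, ∑ y : V, φ (Fin.cons y (Fin.cons x v)) = 0
    have hswap : ∀ x y : V, φ (Fin.cons x (Fin.cons y v)) = -φ (Fin.cons y (Fin.cons x v)) := by
      intro x y
      have h := h₁ (Equiv.swap 0 1) (Fin.cons y (Fin.cons x v))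
      rw [Equiv.Perm.sign_swap (by simp)] at h
      simp only [Units.val_neg, Units.val_one, Int.cast_neg, Int.cast_one, neg_mul, one_mul] at h
      rw [← h]
      congr 1
      funext i
      refine Fin.cases ?_ (fun j => ?_) i
      · simp
      · refine Fin.cases ?_ (fun j => ?_) j
        · simp
        · have hj : Equiv.swap (0 : Fin (n + 1 + 1 + 1)) 1 j.succ.succ = j.succ.succ :=
            Equiv.swap_apply_of_ne_of_ne (Fin.succ_ne_zero _)
              (fun h => Fin.succ_ne_zero j (Fin.succ_injective _ h))
          simp [hj]
    have hdiag : ∀ x : V, φ (Fin.cons x (Fin.cons x v)) = 0 := by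
      intro x
      by_contra h
      have h' := (h₂ _ h).1 (a₁ := 0) (a₂ := 1) (by simp)
      simp at h'
    rw [← Finset.sum_product']
    refine Finset.sum_involution (fun q _ => (q.2, q.1)) ?_ ?_ ?_ ?_
    · rintro ⟨x, y⟩ -
      simp [hswap y x]
    · rintro ⟨x, y⟩ - h heq
      obtain rfl : y = x := congrArg Prod.fst heq
      exact h (hdiag _)
    · rintro ⟨x, y⟩ -
      simp
    · rintro ⟨x, y⟩ -
      rfl

end Homology

/-- The sum complex `X_{A,k}` on the vertex set `ℤ/p`: its faces are all nonempty sets with fewer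
than `k` elements (the full `(k-2)`-skeleton of the simplex) together with the nonempty
sets with exactly `k` elements the sum of whose elements lies in `A`. -/
def sumComplex {p : ℕ} (A : Finset (ZMod p)) (k : ℕ) : PreAbstractSimplicialComplex (ZMod p) where
  faces := {σ | σ.Nonempty ∧ (σ.card < k ∨ (σ.card = k ∧ ∑ x ∈ σ, x ∈ A))}
  isRelLowerSet_faces := by
    rintro σ ⟨hne, hσ⟩
    refine ⟨hne, fun τ hτ hτne => ⟨hτne, ?_⟩⟩
    rcases (show τ ⊆ σ from hτ).eq_or_ssubset with rfl | hlt
    · exact hσ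
    · have := Finset.card_lt_card hlt
      left
      omega

/-- The uncertainty number `u_F(A)` of a subset `A` of a finite abelian group `K`: the minimum of
the ranks of the multiplication operators `T_f : g ↦ f g` on the group algebra `F[K]`, over all
`f` whose support is nonempty and contained in `A`. (For nonempty `A` this is the minimum of a
nonempty set of natural numbers.) -/
def uncertaintyNumber (F : Type*) [Field F] {K : Type*} [AddCommGroup K] [Finite K]
    (A : Finset K) : ℕ :=
  sInf {r : ℕ | ∃ f : AddMonoidAlgebra F K,
    f.coeff.support.Nonempty ∧ f.coeff.support ⊆ A ∧
      r = Module.finrank F (LinearMap.range (LinearMap.mulLeft F f))}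

end SumComplex

end

/-!
For `f` in the group algebra, let `W_f` be the space of functions on `ℤ/p` orthogonal to all
translates of `f` (`translateOrthogonal`). It is the reflected kernel of the multiplication by `f`,
so `rk T_f = p - dim W_f` (`finrank_range_mulLeft_add`), and `u_F(A) = p - d` for the largest
dimension `d` of a space `W_f` with `f ≠ 0` supported in `A`. The complex `X_{A,k}` has no faces with
more than `k` vertices, so its homology in dimension `k - 1` is the space of cycles. The heart of the
proof is that, for `1 < k < p`, nonzero cycles exist if and only if `k ≤ dim W_f` for some such `f`
(`nontrivial_homology_iff_exists_le_finrank`). In dimension `0` every chain is an unreduced cycle,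
which accounts for `k = 1`; the remaining information, `d ≥ |A| - 1` and `d = 0` for `|A| = 1`, is
linear algebra.

If `h_1, …, h_k` in `W_f` are independent, then `v ↦ f(∑ v_j) det(h_i(v_j))` is a cycle: expanding
the determinant along its first column exhibits the boundary as a combination of the sums
`∑_x f(x + s) h_i(x) = 0`. Since `k` is invertible mod `p`, replacing the `h_i` by translates makes
the cycle nonzero (`exists_cycle_of_le_finrank`).

Conversely, let `φ` be a nonzero cycle. If the characteristic of `F` is not `p`, its Fourier transform
is nonzero at some `b = (b_1, …, b_k)`, with distinct entries. On the line `b + t (1, …, 1)` it is the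
Fourier transform of a function `f` supported in `A`, and it vanishes at `t = -b_i`, where a
coordinate is zero. So the `k` characters `x ↦ ψ(-b_i x)` lie in `W_f`
(`exists_le_finrank_of_mem_cycles_of_addChar`).

If the characteristic is `p`, it suffices that nonzero cycles force `k < |A|`, as the polynomials of
degree less than `k` then lie in `W_f` for some `f` supported in `A`. Let `|A| ≤ k` and let `Λ` be the
functional `g ↦ ∑_v φ(v) g(v)` on homogeneous polynomials of the lowest degree for which it could be
nonzero. Let `e₁` be the sum of the variables. On the support of `φ` the polynomial
`∏_{a ∈ A} (e₁ - a)` vanishes, so, up to lower degrees, `Λ` kills all multiples of `e₁ ^ k`; as `φ`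
is an alternating cycle, `Λ` is alternating and kills polynomials in which a variable is missing.
For `E_y` the product of the truncated exponentials of `y_i x_i`, consider the polynomial
`G_y(t) = ∑_{j < k} Λ(e₁ ^ j E_y) t ^ j / j!` of degree less than `k`. As a polynomial in `y_i`, the
value `G_y(-y_i)` is divisible by `y_i ^ p`, has the other `k - 1` coordinates of `y` as roots, and
has degree at most `p + k - 2`. So it vanishes (`sum_shiftCoeff_cons_eq_zero`), `G_y` has the `k`
roots `-y_i` and is zero, hence `Λ(E_y) = 0` for all `y`, and `Λ = 0` (`apply_monomial_eq_zero`).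
Inductively all moments of `φ` vanish, and `φ = 0` (`eq_zero_of_mem_cycles_of_ringHom`).
-/

noncomputable section

namespace SumComplex

/-! ### Alternating functionals on polynomials -/

section TruncatedExponential

open MvPolynomial Finset

variable {F : Type*} [Field F]

/-- The truncated exponential `∑_{r < p} (a x_i) ^ r / r!` in the variable `x_i`. -/
def truncExp {ι : Type*} (p : ℕ) (a : F) (i : ι) : MvPolynomial ι F :=
  ∑ r ∈ range p, C (a ^ r * (r.factorial : F)⁻¹) * X i ^ r

/-- The product over all variables of the truncated exponentials of `y_i x_i`. -/
def truncExpProd {ι : Type*} [Fintype ι] (p : ℕ) (y : ι → F) : MvPolynomial ι F :=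
  ∏ i, truncExp p (y i) i

lemma rename_truncExp {ι κ : Type*} (f : ι → κ) (p : ℕ) (a : F) (i : ι) :
    rename f (truncExp p a i) = truncExp p a (f i) := by
  simp [truncExp]

lemma truncExp_zero {ι : Type*} {p : ℕ} (hp : 0 < p) (i : ι) : truncExp p (0 : F) i = 1 := by
  obtain ⟨q, rfl⟩ := Nat.exists_eq_add_of_lt hp
  simp [truncExp, sum_range_succ']

lemma rename_truncExpProd {ι : Type*} [Fintype ι] (σ : Equiv.Perm ι) (p : ℕ) (y : ι → F) :
    rename σ (truncExpProd p (y ∘ σ)) = truncExpProd p y := by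
  simp only [truncExpProd, map_prod, rename_truncExp, Function.comp]
  exact Equiv.prod_comp σ fun i => truncExp p (y i) i

lemma truncExpProd_cons {m : ℕ} (p : ℕ) (a : F) (y : Fin m → F) :
    truncExpProd p (Fin.cons a y : Fin (m + 1) → F) =
      truncExp p a 0 * rename Fin.succ (truncExpProd p y) := by
  simp [truncExpProd, Fin.prod_univ_succ, rename_truncExp]

lemma rename_sum_X {ι : Type*} [Fintype ι] (σ : Equiv.Perm ι) :
    rename σ (∑ i, X i : MvPolynomial ι F) = ∑ i, X i := by
  simp only [map_sum, rename_X]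
  exact Equiv.sum_comp σ fun i => (X i : MvPolynomial ι F)

/-- The coefficients `Λ(e₁ ^ j E_y) / j!`, where `e₁` is the sum of the variables and `E_y` is
`truncExpProd p y`. For untruncated exponentials these would be the Taylor coefficients in `t` of
`Λ(E_{y + t (1, …, 1)})`. -/
def shiftCoeff {k : ℕ} (p : ℕ) (Λ : MvPolynomial (Fin k) F →ₗ[F] F) (y : Fin k → F) (j : ℕ) : F :=
  (j.factorial : F)⁻¹ * Λ ((∑ i, X i) ^ j * truncExpProd p y)

variable {p m : ℕ} {Λ : MvPolynomial (Fin (m + 1)) F →ₗ[F] F}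

lemma shiftCoeff_comp_swap
    (hswap : ∀ i j, i ≠ j → ∀ g, Λ (rename (Equiv.swap i j) g) = -Λ g)
    {i j : Fin (m + 1)} (hij : i ≠ j) (y : Fin (m + 1) → F) (r : ℕ) :
    shiftCoeff p Λ (y ∘ Equiv.swap i j) r = -shiftCoeff p Λ y r := by
  have h := hswap i j hij ((∑ i, X i) ^ r * truncExpProd p (y ∘ Equiv.swap i j))
  rw [map_mul, map_pow, rename_sum_X, rename_truncExpProd] at h
  simp [shiftCoeff, h]

lemma shiftCoeff_eq_zero_of_eq (h2 : (2 : F) ≠ 0)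
    (hswap : ∀ i j, i ≠ j → ∀ g, Λ (rename (Equiv.swap i j) g) = -Λ g)
    {i j : Fin (m + 1)} (hij : i ≠ j) {y : Fin (m + 1) → F} (hy : y i = y j) (r : ℕ) :
    shiftCoeff p Λ y r = 0 := by
  have h := shiftCoeff_comp_swap (p := p) hswap hij y r
  have hyc : y ∘ Equiv.swap i j = y := by
    funext l
    by_cases hi : l = i
    · simp [hi, hy]
    by_cases hj : l = j
    · simp [hj, hy]
    · simp [Equiv.swap_apply_of_ne_of_ne hi hj]
  rw [hyc, eq_neg_iff_add_eq_zero, ← two_mul] at h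
  exact (mul_eq_zero.1 h).resolve_left h2

/-- As a polynomial in the first coordinate `a` of the point, the translation polynomial at
`t = -a` is divisible by `X ^ p` (its coefficients below degree `p` are values of `Λ` at
polynomials `(x₀ - e₁) ^ q E`, in which `x₀` does not occur), it vanishes at the other coordinates,
and its degree is too small for that. -/
lemma sum_shiftCoeff_cons_eq_zero (hp : 0 < p) (hfact : ∀ r < p, (r.factorial : F) ≠ 0)
    (h2 : (2 : F) ≠ 0)
    (hpow : ∀ j, m + 1 ≤ j → ∀ g, Λ ((∑ i, X i) ^ j * g) = 0)
    (hsucc : ∀ g, Λ (rename Fin.succ g) = 0)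
    (hswap : ∀ i j, i ≠ j → ∀ g, Λ (rename (Equiv.swap i j) g) = -Λ g)
    (a : F) {y : Fin m → F} (hy : Function.Injective y) (hy0 : ∀ i, y i ≠ 0) :
    ∑ j ∈ range (m + 1), shiftCoeff p Λ (Fin.cons a y) j * (-a) ^ j = 0 := by
  set E : MvPolynomial (Fin (m + 1)) F := rename Fin.succ (truncExpProd p y) with hE
  let b : ℕ × ℕ → F := fun x => (-1) ^ x.1 * ((x.1.factorial : F)⁻¹ * (x.2.factorial : F)⁻¹ *
    Λ ((∑ i, X i) ^ x.1 * (X 0 ^ x.2 * E)))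
  let P : Polynomial F := ∑ x ∈ range (m + 1) ×ˢ range p, Polynomial.monomial (x.1 + x.2) (b x)
  have hb : ∀ x : ℕ × ℕ, m + 1 ≤ x.1 → b x = 0 := fun x hx => by
    simp [b, hpow x.1 hx]
  have hPeval : ∀ c : F, P.eval c =
      ∑ j ∈ range (m + 1), shiftCoeff p Λ (Fin.cons c y) j * (-c) ^ j := by
    intro c
    simp only [P, Polynomial.eval_finsetSum, sum_product, Polynomial.eval_monomial]
    refine sum_congr rfl fun j _ => ?_
    have h1 : (∑ i, X i : MvPolynomial (Fin (m + 1)) F) ^ j *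
        truncExpProd p (Fin.cons c y : Fin (m + 1) → F) =
        ∑ r ∈ range p, (c ^ r * (r.factorial : F)⁻¹) • ((∑ i, X i) ^ j * (X 0 ^ r * E)) := by
      rw [truncExpProd_cons, truncExp, sum_mul, mul_sum]
      refine sum_congr rfl fun r _ => ?_
      rw [smul_eq_C_mul]
      ring
    rw [shiftCoeff, h1, map_sum, mul_sum, sum_mul]
    refine sum_congr rfl fun r _ => ?_
    simp only [b, map_smul, smul_eq_mul]
    rw [neg_pow c j, pow_add]
    ring
  have hcoeff : ∀ q < p, P.coeff q = 0 := by
    intro q hq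
    have h1 : P.coeff q = ∑ x ∈ antidiagonal q, b x := by
      simp only [P, Polynomial.finsetSum_coeff, Polynomial.coeff_monomial]
      rw [← sum_filter]
      refine sum_subset_zero_on_sdiff ?_ ?_ fun _ _ => rfl
      · intro x hx
        simpa using (mem_filter.1 hx).2
      · intro x hx
        rw [mem_sdiff, HasAntidiagonal.mem_antidiagonal, mem_filter, mem_product, mem_range,
          mem_range] at hx
        exact hb x (by omega)
    have h2 : ∑ x ∈ antidiagonal q, b x =
        (q.factorial : F)⁻¹ * Λ ((-∑ i, X i + X 0) ^ q * E) := by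
      rw [(Commute.all _ _).add_pow', sum_mul, map_sum, mul_sum]
      refine sum_congr rfl fun x hx => ?_
      obtain rfl : x.1 + x.2 = q := HasAntidiagonal.mem_antidiagonal.1 hx
      have h3 : (-∑ i, X i : MvPolynomial (Fin (m + 1)) F) ^ x.1 * X 0 ^ x.2 * E =
          ((-1 : F) ^ x.1) • ((∑ i, X i) ^ x.1 * (X 0 ^ x.2 * E)) := by
        rw [neg_pow, smul_eq_C_mul]
        simp only [map_pow, map_neg, map_one]
        ring
      rw [smul_mul_assoc, map_nsmul, h3, map_smul, nsmul_eq_mul, smul_eq_mul]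
      have h4 : ((x.1 + x.2).choose x.1 : F) * (x.1.factorial * x.2.factorial) =
          (x.1 + x.2).factorial := by
        rw [← mul_assoc, Nat.choose_symm_add]
        exact_mod_cast congrArg (Nat.cast : ℕ → F)
          (Nat.add_choose_mul_factorial_mul_factorial x.1 x.2)
      have hq' := hfact _ hq
      have h5 := hfact x.1 (by omega)
      have h6 := hfact x.2 (by omega)
      simp only [b]
      rw [← h4] at hq' ⊢
      have h7 : ((x.1 + x.2).choose x.1 : F) ≠ 0 := left_ne_zero_of_mul hq'
      field_simp
    have h3 : (-∑ i, X i + X 0 : MvPolynomial (Fin (m + 1)) F) ^ q * E =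
        rename Fin.succ ((-∑ i, X i) ^ q * truncExpProd p y) := by
      rw [map_mul, map_pow, map_neg, map_sum, Fin.sum_univ_succ]
      simp [hE]
    rw [h1, h2, h3, hsucc, mul_zero]
  obtain ⟨Q, hQ⟩ := Polynomial.X_pow_dvd_iff.2 hcoeff
  have hQroot : ∀ i, Q.eval (y i) = 0 := by
    intro i
    have h1 : P.eval (y i) = 0 := by
      rw [hPeval]
      refine sum_eq_zero fun j _ => ?_
      rw [shiftCoeff_eq_zero_of_eq h2 hswap (i := 0) (j := i.succ) (Fin.succ_ne_zero i).symm
        (by simp), zero_mul]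
    rw [hQ] at h1
    simpa [hy0 i] using h1
  have hQ0 : Q = 0 := by
    by_contra hne
    have hdeg : P.natDegree ≤ m + (p - 1) := by
      refine Polynomial.natDegree_sum_le_of_forall_le _ _ fun x hx => ?_
      rw [mem_product, mem_range, mem_range] at hx
      exact (Polynomial.natDegree_monomial_le _).trans (by omega)
    have hdeg' : P.natDegree = p + Q.natDegree := by
      rw [hQ, Polynomial.natDegree_mul (pow_ne_zero _ Polynomial.X_ne_zero) hne,
        Polynomial.natDegree_X_pow]
    refine hne (Polynomial.eq_zero_of_natDegree_lt_card_of_eval_eq_zero Q hy hQroot ?_)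
    rw [Fintype.card_fin]
    omega
  rw [← hPeval, hQ, hQ0, mul_zero, Polynomial.eval_zero]

/-- A polynomial `∑_{j ≤ m} c_j t ^ j` with the `m + 1` distinct roots `-y_i` is zero. -/
lemma apply_truncExpProd_eq_zero (hp : 0 < p) (hfact : ∀ r < p, (r.factorial : F) ≠ 0)
    (h2 : (2 : F) ≠ 0)
    (hpow : ∀ j, m + 1 ≤ j → ∀ g, Λ ((∑ i, X i) ^ j * g) = 0)
    (hsucc : ∀ g, Λ (rename Fin.succ g) = 0)
    (hswap : ∀ i j, i ≠ j → ∀ g, Λ (rename (Equiv.swap i j) g) = -Λ g)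
    (y : Fin (m + 1) → F) : Λ (truncExpProd p y) = 0 := by
  have hshift : shiftCoeff p Λ y 0 = Λ (truncExpProd p y) := by simp [shiftCoeff]
  rw [← hshift]
  by_cases hinj : Function.Injective y
  swap
  · simp only [Function.Injective, not_forall] at hinj
    obtain ⟨i, j, hij, hne⟩ := hinj
    exact shiftCoeff_eq_zero_of_eq h2 hswap hne hij 0
  -- A coordinate `i` can be moved to the front at the cost of a sign.
  have hfront : ∀ i, ∃ ε : F, ε ≠ 0 ∧ ∀ r, shiftCoeff p Λ (y ∘ Equiv.swap 0 i) r =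
      ε * shiftCoeff p Λ y r := by
    intro i
    by_cases hi : 0 = i
    · exact ⟨1, one_ne_zero, fun r => by simp [← hi]⟩
    · exact ⟨-1, by simp, fun r => by rw [shiftCoeff_comp_swap hswap hi]; simp⟩
  by_cases h0 : ∃ i, y i = 0
  · obtain ⟨i, hi⟩ := h0
    obtain ⟨ε, hε, h⟩ := hfront i
    have h1 := h 0
    rw [← Fin.cons_self_tail (y ∘ Equiv.swap 0 i)] at h1
    simp only [Function.comp, Equiv.swap_apply_left, hi] at h1
    rw [shiftCoeff, truncExpProd_cons, truncExp_zero hp, pow_zero, one_mul, one_mul, hsucc] at h1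
    simpa [hε] using h1.symm
  push Not at h0
  let G : Polynomial F := ∑ j ∈ range (m + 1), Polynomial.monomial j (shiftCoeff p Λ y j)
  have hG : G = 0 := by
    refine Polynomial.eq_zero_of_natDegree_lt_card_of_eval_eq_zero G
      (f := fun i => -y i) (neg_injective.comp hinj) (fun i => ?_) ?_
    · obtain ⟨ε, hε, h⟩ := hfront i
      have hy' := hinj.comp (Equiv.swap 0 i).injective
      have h1 := sum_shiftCoeff_cons_eq_zero hp hfact h2 hpow hsucc hswap
        ((y ∘ Equiv.swap 0 i) 0) (y := Fin.tail (y ∘ Equiv.swap 0 i))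
        (hy'.comp (Fin.succ_injective _)) (fun j => h0 _)
      rw [Fin.cons_self_tail] at h1
      simp only [h, mul_assoc, ← mul_sum] at h1
      simp only [Function.comp, Equiv.swap_apply_left] at h1
      simpa [G, Polynomial.eval_finsetSum, hε] using h1
    · rw [Fintype.card_fin, Nat.lt_succ_iff]
      refine Polynomial.natDegree_sum_le_of_forall_le _ _ fun j hj => ?_
      exact (Polynomial.natDegree_monomial_le _).trans (Nat.lt_succ_iff.1 (mem_range.1 hj))
  have h1 := congrArg (fun Q => Polynomial.coeff Q 0) hG
  simpa [G, Polynomial.finsetSum_coeff, Polynomial.coeff_monomial] using h1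

/-- The values `Λ(x ^ n)`, with `n_i < p` for all `i`, are up to the factor `∏ n_i!` the
coefficients of the polynomial function `y ↦ Λ(E_y)`, which vanishes. -/
theorem apply_monomial_eq_zero [Infinite F] (hp : 0 < p) (hfact : ∀ r < p, (r.factorial : F) ≠ 0)
    (h2 : (2 : F) ≠ 0)
    (hpow : ∀ j, m + 1 ≤ j → ∀ g, Λ ((∑ i, X i) ^ j * g) = 0)
    (hsucc : ∀ g, Λ (rename Fin.succ g) = 0)
    (hswap : ∀ i j, i ≠ j → ∀ g, Λ (rename (Equiv.swap i j) g) = -Λ g)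
    (n : Fin (m + 1) →₀ ℕ) (hn : ∀ i, n i < p) : Λ (monomial n 1) = 0 := by
  have hmon : ∀ d : Fin (m + 1) → ℕ,
      (monomial (Finsupp.equivFunOnFinite.symm d) (1 : F)) = ∏ i, X i ^ d i := by
    intro d
    rw [monomial_eq, map_one, one_mul, Finsupp.prod_fintype _ _ (fun _ => by simp)]
    simp
  let R : MvPolynomial (Fin (m + 1)) F :=
    ∑ d ∈ Fintype.piFinset fun _ : Fin (m + 1) => range p,
      monomial (Finsupp.equivFunOnFinite.symm d)
        ((∏ i, ((d i).factorial : F)⁻¹) * Λ (monomial (Finsupp.equivFunOnFinite.symm d) 1))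
  have hR : R = 0 := by
    refine MvPolynomial.funext fun y => ?_
    rw [map_zero, ← apply_truncExpProd_eq_zero hp hfact h2 hpow hsucc hswap y]
    simp only [R, truncExpProd, truncExp]
    rw [prod_univ_sum, map_sum, map_sum]
    refine sum_congr rfl fun d _ => ?_
    rw [prod_mul_distrib, ← map_prod, ← smul_eq_C_mul, map_smul, ← hmon, eval_monomial,
      Finsupp.prod_fintype _ _ (fun _ => by simp), prod_mul_distrib]
    simp only [Finsupp.equivFunOnFinite_symm_apply_apply, smul_eq_mul]
    ring
  have h1 := congrArg (coeff n) hR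
  rw [coeff_zero] at h1
  simp only [R, coeff_sum, coeff_monomial] at h1
  rw [sum_eq_single (n : Fin (m + 1) → ℕ)] at h1
  · simp only [Finsupp.equivFunOnFinite_symm_coe, if_true, mul_eq_zero] at h1
    refine h1.resolve_left (prod_ne_zero_iff.2 fun i _ => inv_ne_zero (hfact _ (hn i)))
  · intro d _ hd
    rw [if_neg]
    rintro rfl
    exact hd (by simp)
  · intro h
    exact absurd (Fintype.mem_piFinset.2 fun i => mem_range.2 (hn i)) h

end TruncatedExponential

/-! ### Cycles of the sum complex -/

section Cycles

variable {p : ℕ} [Fact p.Prime] {F : Type*} [Field F] {A : Finset (ZMod p)}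

/-- The chains of `sumComplex A k` in dimension `k` vanish, so in dimension `k - 1` the homology
is the space of cycles. -/
lemma nontrivial_homology_iff (n : ℕ) :
    Nontrivial (Homology (sumComplex A (n + 1)) F n) ↔
      ∃ φ ∈ cycles (sumComplex A (n + 1)) F n, φ ≠ 0 := by
  have hchains : chains (sumComplex A (n + 1)) F (n + 1) = ⊥ := by
    refine (Submodule.eq_bot_iff _).2 fun φ hφ => funext fun v => ?_
    by_contra hv
    obtain ⟨hinj, -, hcard⟩ := hφ.2 v hv
    rw [Finset.card_image_of_injective _ hinj, Finset.card_univ, Fintype.card_fin] at hcard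
    omega
  have hbound : boundaries (sumComplex A (n + 1)) F n = ⊥ := by
    rw [boundaries, hchains, Submodule.map_bot]
  rw [Submodule.Quotient.nontrivial_iff, hbound, Ne, Submodule.submoduleOf_eq_top,
    le_bot_iff, Submodule.eq_bot_iff]
  push Not
  rfl

lemma mem_cycles_sumComplex_iff {n : ℕ} {φ : (Fin (n + 2) → ZMod p) → F} :
    φ ∈ cycles (sumComplex A (n + 2)) F (n + 1) ↔
      (∀ (σ : Equiv.Perm (Fin (n + 2))) (v : Fin (n + 2) → ZMod p),
        φ (v ∘ σ) = ((Equiv.Perm.sign σ : ℤ) : F) * φ v) ∧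
      (∀ v, φ v ≠ 0 → Function.Injective v ∧ ∑ i, v i ∈ A) ∧
      ∀ w : Fin (n + 1) → ZMod p, ∑ x, φ (Fin.cons x w) = 0 := by
  have hface : ∀ v : Fin (n + 2) → ZMod p, Function.Injective v →
      (Finset.univ.image v ∈ (sumComplex A (n + 2)).faces ↔ ∑ i, v i ∈ A) := by
    intro v hv
    have hcard : (Finset.univ.image v).card = n + 2 := by
      rw [Finset.card_image_of_injective _ hv, Finset.card_univ, Fintype.card_fin]
    have hsum : ∑ x ∈ Finset.univ.image v, x = ∑ i, v i :=
      Finset.sum_image fun a _ b _ h => hv h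
    change (Finset.univ.image v).Nonempty ∧ (_ < _ ∨ _ = _ ∧ _ ∈ A) ↔ _
    rw [hcard, hsum]
    simp
  constructor
  · rintro ⟨⟨h1, h2⟩, h3⟩
    exact ⟨h1, fun v hv => ⟨(h2 v hv).1, (hface v (h2 v hv).1).1 (h2 v hv).2⟩,
      fun w => congrFun h3 w⟩
  · rintro ⟨h1, h2, h3⟩
    exact ⟨⟨h1, fun v hv => ⟨(h2 v hv).1, (hface v (h2 v hv).1).2 (h2 v hv).2⟩⟩, funext h3⟩

end Cycles

/-! ### Cycles in the defining characteristic -/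

section Moments

open MvPolynomial Finset

variable {p : ℕ} [Fact p.Prime] {F : Type*} [Field F] {A : Finset (ZMod p)}

/-- The linear functional `g ↦ ∑ v, φ(v) g(v)` on polynomials; a ring homomorphism `c` from
`ZMod p` to the coefficient field makes tuples in `ZMod p` points at which `g` can be evaluated. -/
def moment {k : ℕ} (c : ZMod p →+* F) (φ : (Fin k → ZMod p) → F) :
    MvPolynomial (Fin k) F →ₗ[F] F where
  toFun g := ∑ v, φ v * eval (fun i => c (v i)) g
  map_add' g h := by simp [mul_add, sum_add_distrib]
  map_smul' a g := by
    simp only [smul_eval, RingHom.id_apply, smul_eq_mul, mul_sum]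
    exact sum_congr rfl fun v _ => by ring

lemma moment_apply {k : ℕ} (c : ZMod p →+* F) (φ : (Fin k → ZMod p) → F)
    (g : MvPolynomial (Fin k) F) : moment c φ g = ∑ v, φ v * eval (fun i => c (v i)) g := rfl

lemma moment_rename_swap {k : ℕ} (c : ZMod p →+* F) {φ : (Fin k → ZMod p) → F}
    (hφ : ∀ (σ : Equiv.Perm (Fin k)) (v : Fin k → ZMod p),
      φ (v ∘ σ) = ((Equiv.Perm.sign σ : ℤ) : F) * φ v)
    {i j : Fin k} (hij : i ≠ j) (g : MvPolynomial (Fin k) F) :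
    moment c φ (rename (Equiv.swap i j) g) = -moment c φ g := by
  rw [moment_apply, moment_apply, ← sum_neg_distrib,
    ← Equiv.sum_comp ((Equiv.swap i j).arrowCongr (Equiv.refl (ZMod p)))]
  refine sum_congr rfl fun v _ => ?_
  have h1 : ((Equiv.swap i j).arrowCongr (Equiv.refl (ZMod p))) v = v ∘ Equiv.swap i j := by
    funext l
    simp [Equiv.arrowCongr]
  rw [h1, hφ, Equiv.Perm.sign_swap hij, eval_rename]
  have h2 : (fun i_1 => c ((v ∘ Equiv.swap i j) i_1)) ∘ Equiv.swap i j = fun l => c (v l) := by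
    funext l
    simp
  rw [h2]
  simp

lemma moment_rename_succ {k : ℕ} (c : ZMod p →+* F) {φ : (Fin (k + 1) → ZMod p) → F}
    (hφ : ∀ w : Fin k → ZMod p, ∑ x, φ (Fin.cons x w) = 0) (g : MvPolynomial (Fin k) F) :
    moment c φ (rename Fin.succ g) = 0 := by
  rw [moment_apply, ← Equiv.sum_comp (Fin.consEquiv fun _ => ZMod p), Fintype.sum_prod_type_right]
  refine sum_eq_zero fun w _ => ?_
  have h1 : ∀ x : ZMod p, φ (Fin.consEquiv (fun _ => ZMod p) (x, w)) *
      eval (fun i => c (Fin.consEquiv (fun _ => ZMod p) (x, w) i)) (rename Fin.succ g) =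
      φ (Fin.cons x w) * eval (fun i => c (w i)) g := by
    intro x
    rw [eval_rename]
    rfl
  rw [sum_congr rfl fun x _ => h1 x, ← sum_mul, hφ, zero_mul]

/-- If all moments of degree less than `D` vanish, then so does every moment of degree `D` that
contains the factor `e₁ ^ k`, `k` the size of `A`: the sum of the entries of a tuple in the
support of `φ` is a root of the monic polynomial `∏_{a ∈ A} (X - a)`. -/
lemma moment_pow_mul_monomial {k D : ℕ} (c : ZMod p →+* F) {φ : (Fin k → ZMod p) → F}
    (hsum : ∀ v, φ v ≠ 0 → ∑ i, v i ∈ A)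
    (hlow : ∀ n : Fin k →₀ ℕ, n.degree < D → moment c φ (monomial n 1) = 0)
    {j : ℕ} (hj : A.card ≤ j) (n : Fin k →₀ ℕ) (hn : j + n.degree = D) :
    moment c φ ((∑ i, X i) ^ j * monomial n 1) = 0 := by
  have hhom : ∀ (d : ℕ) (g : MvPolynomial (Fin k) F), d < D → g.IsHomogeneous d →
      moment c φ g = 0 := by
    intro d g hd hg
    rw [g.as_sum, map_sum]
    refine sum_eq_zero fun n hn => ?_
    have h1 : monomial n (coeff n g) = coeff n g • monomial n (1 : F) := by
      rw [smul_monomial, smul_eq_mul, mul_one]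
    have h2 : n.degree = d := by
      rw [Finsupp.degree_eq_weight_one]
      exact hg (mem_support_iff.1 hn)
    rw [h1, map_smul, hlow n (h2 ▸ hd), smul_zero]
  have he1 : (∑ i, X i : MvPolynomial (Fin k) F).IsHomogeneous 1 :=
    IsHomogeneous.sum _ _ _ fun i _ => isHomogeneous_X F i
  have hmon : (monomial n (1 : F)).IsHomogeneous n.degree :=
    isHomogeneous_monomial 1 rfl
  let Q : Polynomial F := Polynomial.X ^ (j - A.card) * ∏ a ∈ A, (Polynomial.X - Polynomial.C (c a))
  have hQm : Q.Monic := (Polynomial.monic_X_pow _).mul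
    (Polynomial.monic_prod_of_monic _ _ fun a _ => Polynomial.monic_X_sub_C _)
  have hQd : Q.natDegree = j := by
    rw [(Polynomial.monic_X_pow _).natDegree_mul
      (Polynomial.monic_prod_of_monic _ _ fun a _ => Polynomial.monic_X_sub_C _),
      Polynomial.natDegree_X_pow, Polynomial.natDegree_prod_of_monic _ _
        (fun a _ => Polynomial.monic_X_sub_C _)]
    simp [hj]
  have hQz : moment c φ (Polynomial.aeval (∑ i, X i : MvPolynomial (Fin k) F) Q *
      monomial n 1) = 0 := by
    rw [moment_apply]
    refine sum_eq_zero fun v _ => ?_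
    by_cases hv : φ v = 0
    · rw [hv, zero_mul]
    have h1 : ∏ a ∈ A, (∑ i, c (v i) - c a) = 0 :=
      prod_eq_zero (hsum v hv) (by rw [← map_sum, sub_self])
    simp only [Q, map_mul, map_prod, map_sub, Polynomial.aeval_X, Polynomial.aeval_C, map_sum,
      eval_X, algebraMap_eq, eval_C, h1, mul_zero, zero_mul]
  have hQs : Polynomial.aeval (∑ i, X i : MvPolynomial (Fin k) F) Q =
      (∑ i, X i) ^ j + ∑ i ∈ range j, C (Q.coeff i) * (∑ i, X i) ^ i := by
    rw [Polynomial.aeval_eq_sum_range, hQd, sum_range_succ, add_comm]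
    congr 1
    · rw [← hQd, hQm.coeff_natDegree, one_smul]
    · exact sum_congr rfl fun i _ => smul_eq_C_mul _ _
  have hrest : moment c φ ((∑ i ∈ range j, C (Q.coeff i) * (∑ i, X i) ^ i) * monomial n 1) = 0 := by
    rw [sum_mul, map_sum]
    refine sum_eq_zero fun i hi => ?_
    rw [mul_assoc, ← smul_eq_C_mul, map_smul,
      hhom (1 * i + n.degree) _ (by have := mem_range.1 hi; omega) ((he1.pow i).mul hmon), smul_zero]
  rwa [hQs, add_mul, map_add, hrest, add_zero] at hQz

/-- In characteristic `p` the sum complex of at most `n + 2 < p` sums has no nonzero cycles of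
dimension `n + 1`: the functional that evaluates the moments of the lowest degree vanishes by
`apply_monomial_eq_zero`. -/
theorem eq_zero_of_mem_cycles_of_ringHom [Infinite F] (c : ZMod p →+* F) {n : ℕ} (hn : n + 2 < p)
    (hA : A.card ≤ n + 2) {φ : (Fin (n + 2) → ZMod p) → F}
    (hφ : φ ∈ cycles (sumComplex A (n + 2)) F (n + 1)) : φ = 0 := by
  obtain ⟨hperm, hsupp, hcyc⟩ := mem_cycles_sumComplex_iff.1 hφ
  have hcast : ∀ r : ℕ, (r : F) = c r := fun r => by simp
  have hfact : ∀ r < p, (r.factorial : F) ≠ 0 := by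
    intro r hr h
    rw [hcast, map_eq_zero_iff c c.injective, ZMod.natCast_eq_zero_iff,
      (Fact.out : p.Prime).dvd_factorial] at h
    omega
  have h2 : (2 : F) ≠ 0 := by simpa using hfact 2 (by omega)
  have hmon : ∀ (D : ℕ) (d : Fin (n + 2) →₀ ℕ), d.degree = D →
      moment c φ (monomial d 1) = 0 := by
    intro D
    induction D using Nat.strong_induction_on with
    | _ D ih =>
      intro d hd
      by_cases hbig : ∃ i, p ≤ d i
      · -- Fermat's little theorem lowers an exponent that is at least `p` by `p - 1`.
        obtain ⟨i, hi⟩ := hbig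
        obtain ⟨e, rfl⟩ : ∃ e, d = e + Finsupp.single i p :=
          ⟨d - Finsupp.single i p, (tsub_add_cancel_of_le (Finsupp.single_le_iff.2 hi)).symm⟩
        have h1 : moment c φ (monomial (e + Finsupp.single i p) 1) =
            moment c φ (monomial (e + Finsupp.single i 1) 1) := by
          rw [moment_apply, moment_apply]
          refine sum_congr rfl fun v _ => ?_
          rw [monomial_add_single, monomial_add_single]
          simp only [map_mul, map_pow, eval_X, ← map_pow c, ZMod.pow_card, pow_one]
        have hp := (Fact.out : p.Prime).one_lt
        rw [h1]
        simp only [map_add, Finsupp.degree_single] at hd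
        exact ih (e.degree + 1) (by omega) _ (by simp)
      · push Not at hbig
        have hhomd : (monomial d (1 : F)).IsHomogeneous D := isHomogeneous_monomial 1 hd
        have key := apply_monomial_eq_zero (p := p)
          (Λ := moment c φ ∘ₗ homogeneousComponent D)
          (Fact.out : p.Prime).pos hfact h2 ?_ ?_ ?_ d hbig
        · rwa [LinearMap.comp_apply, homogeneousComponent_eq_self hhomd] at key
        · intro j hj g
          induction g using MvPolynomial.induction_on' with
          | add g h hg hh => rw [mul_add, map_add, hg, hh, add_zero]
          | monomial e a =>
            have h1 : monomial e a = a • monomial e (1 : F) := by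
              rw [smul_monomial, smul_eq_mul, mul_one]
            have h3 : ((∑ i, X i) ^ j * monomial e (1 : F)).IsHomogeneous (1 * j + e.degree) :=
              ((IsHomogeneous.sum _ _ _ fun i _ => isHomogeneous_X F i).pow j).mul
                (isHomogeneous_monomial 1 rfl)
            rw [h1, mul_smul_comm, map_smul, LinearMap.comp_apply, homogeneousComponent_of_mem h3]
            split_ifs with h4
            · rw [moment_pow_mul_monomial c (fun v hv => (hsupp v hv).2)
                (fun e he => ih _ he e rfl) (hA.trans hj) e (by omega), smul_zero]
            · rw [map_zero, smul_zero]
        · intro g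
          rw [LinearMap.comp_apply, ← rename_homogeneousComponent, moment_rename_succ c hcyc]
        · intro i j hij g
          rw [LinearMap.comp_apply, ← rename_homogeneousComponent, moment_rename_swap c hperm hij,
            LinearMap.comp_apply]
  have hall : ∀ g, moment c φ g = 0 := by
    intro g
    induction g using MvPolynomial.induction_on' with
    | add g h hg hh => rw [map_add, hg, hh, add_zero]
    | monomial e a =>
      have h1 : monomial e a = a • monomial e (1 : F) := by
        rw [smul_monomial, smul_eq_mul, mul_one]
      rw [h1, map_smul, hmon _ e rfl, smul_zero]
  funext u
  -- The polynomial `∏ i, (1 - (x_i - u_i) ^ (p - 1))` is the indicator function of `u`.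
  have h := hall (∏ i, (1 - (X i - C (c (u i))) ^ (p - 1)))
  rw [moment_apply, sum_eq_single u] at h
  · have hp := (Fact.out : p.Prime).one_lt
    have hp' : p - 1 ≠ 0 := by omega
    simpa [map_prod, hp'] using h
  · intro v _ hv
    obtain ⟨i, hi⟩ := Function.ne_iff.1 hv
    rw [map_prod, prod_eq_zero (mem_univ i), mul_zero]
    simp only [map_sub, map_one, map_pow, eval_X, eval_C]
    rw [← map_sub c, ← map_pow, ZMod.pow_card_sub_one_eq_one (sub_ne_zero.2 hi), map_one, sub_self]
  · intro h
    exact absurd (mem_univ u) h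

end Moments

/-! ### The kernel of a multiplication operator -/

section Orthogonal

open Finset Module

variable {p : ℕ} [Fact p.Prime] {F : Type*} [Field F]

/-- The functions orthogonal to all translates of `f`. Up to the reflection `x ↦ -x` this is the
kernel of the multiplication by `f` in the group algebra. -/
def translateOrthogonal (f : ZMod p → F) : Submodule F (ZMod p → F) where
  carrier := {h | ∀ s, ∑ x, f (x + s) * h x = 0}
  zero_mem' := fun s => by simp
  add_mem' := fun {g h} hg hh s => by simp [mul_add, sum_add_distrib, hg s, hh s]
  smul_mem' := fun c h hh s => by
    simp only [Pi.smul_apply, smul_eq_mul, mul_left_comm _ c, ← mul_sum, hh s, mul_zero]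

lemma mem_translateOrthogonal {f h : ZMod p → F} :
    h ∈ translateOrthogonal f ↔ ∀ s, ∑ x, f (x + s) * h x = 0 := Iff.rfl

lemma translate_mem_translateOrthogonal {f h : ZMod p → F} (hh : h ∈ translateOrthogonal f)
    (t : ZMod p) : (fun x => h (x - t)) ∈ translateOrthogonal f := by
  intro s
  rw [← hh (s + t), ← Equiv.sum_comp (Equiv.addRight t)]
  refine sum_congr rfl fun x _ => ?_
  simp only [Equiv.coe_addRight, add_sub_cancel_right]
  congr 2
  ring

lemma le_finrank_translateOrthogonal {f : ZMod p → F} {k : ℕ} {h : Fin k → ZMod p → F}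
    (hli : LinearIndependent F h) (hmem : ∀ i, h i ∈ translateOrthogonal f) :
    k ≤ finrank F (translateOrthogonal f) := by
  have h1 := finrank_span_eq_card hli
  rw [Fintype.card_fin] at h1
  rw [← h1]
  refine Submodule.finrank_mono (Submodule.span_le.2 ?_)
  rintro _ ⟨i, rfl⟩
  exact hmem i

lemma finrank_translateOrthogonal_lt {f : ZMod p → F} (hf : f ≠ 0) :
    finrank F (translateOrthogonal f) < p := by
  have hne : translateOrthogonal f ≠ ⊤ := by
    intro htop
    refine hf (funext fun a => ?_)
    have h1 : Pi.single 0 1 ∈ translateOrthogonal f := htop ▸ Submodule.mem_top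
    simpa [Pi.single_apply] using h1 a
  have h2 := Submodule.finrank_lt hne
  rwa [finrank_fintype_fun_eq_card, ZMod.card] at h2

theorem finrank_range_mulLeft_add (f : AddMonoidAlgebra F (ZMod p)) :
    finrank F (LinearMap.range (LinearMap.mulLeft F f)) +
      finrank F (translateOrthogonal (f.coeff : ZMod p → F)) = p := by
  let e : AddMonoidAlgebra F (ZMod p) ≃ₗ[F] (ZMod p → F) :=
    (AddMonoidAlgebra.coeffLinearEquiv F).trans
      ((Finsupp.linearEquivFunOnFinite F F (ZMod p)).trans
        (LinearEquiv.funCongrLeft F F (Equiv.neg (ZMod p))))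
  have he : ∀ g x, e g x = g.coeff (-x) := fun g x => rfl
  have hfin : FiniteDimensional F (AddMonoidAlgebra F (ZMod p)) := e.symm.finiteDimensional
  have hker : (LinearMap.ker (LinearMap.mulLeft F f)).map e.toLinearMap =
      translateOrthogonal (f.coeff : ZMod p → F) := by
    have hcoeff : ∀ g s, (f * g).coeff s = ∑ x, f.coeff (x + s) * e g x := by
      intro g s
      rw [AddMonoidAlgebra.coeff_mul, Finsupp.sum_fintype _ _ (fun _ => by simp),
        ← Equiv.sum_comp (Equiv.addRight s)]
      refine sum_congr rfl fun x _ => ?_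
      rw [Finsupp.sum_fintype _ _ (fun _ => by simp), sum_eq_single (-x)]
      · simp [he]
      · intro y _ hy
        rw [if_neg]
        intro h
        refine hy ?_
        simp only [Equiv.coe_addRight] at h
        linear_combination h
      · simp
    ext h
    rw [Submodule.mem_map_equiv, LinearMap.mem_ker, LinearMap.mulLeft_apply,
      mem_translateOrthogonal, ← AddMonoidAlgebra.coeff_eq_zero, DFunLike.ext_iff]
    simp only [hcoeff, LinearEquiv.apply_symm_apply, Finsupp.coe_zero, Pi.zero_apply]
  rw [← hker, LinearEquiv.finrank_map_eq, LinearMap.finrank_range_add_finrank_ker, e.finrank_eq,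
    finrank_fintype_fun_eq_card, ZMod.card]

/-- The largest dimension of the kernel of the multiplication by a nonzero element supported in `A`
is complementary to the uncertainty number. -/
theorem uncertaintyNumber_add_eq {A : Finset (ZMod p)} {d : ℕ}
    (hd : IsGreatest {d | ∃ f : ZMod p → F, f ≠ 0 ∧ (∀ x, f x ≠ 0 → x ∈ A) ∧
      d = finrank F (translateOrthogonal f)} d) :
    uncertaintyNumber F A + d = p := by
  obtain ⟨⟨f, hf, hfA, hfd⟩, hmax⟩ := hd
  have hle : d < p := hfd ▸ finrank_translateOrthogonal_lt hf
  have hleast : IsLeast {r : ℕ | ∃ f : AddMonoidAlgebra F (ZMod p),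
      f.coeff.support.Nonempty ∧ f.coeff.support ⊆ A ∧
        r = finrank F (LinearMap.range (LinearMap.mulLeft F f))} (p - d) := by
    constructor
    · refine ⟨.ofCoeff (Finsupp.equivFunOnFinite.symm f), ?_, ?_, ?_⟩
      · obtain ⟨x, hx⟩ := Function.ne_iff.1 hf
        exact ⟨x, by simpa using hx⟩
      · intro x hx
        exact hfA x (by simpa using hx)
      · have h1 := finrank_range_mulLeft_add (.ofCoeff (Finsupp.equivFunOnFinite.symm f) :
          AddMonoidAlgebra F (ZMod p))
        have h2 : finrank F (translateOrthogonal
          (AddMonoidAlgebra.ofCoeff (Finsupp.equivFunOnFinite.symm f)).coeff) = d := hfd.symm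
        omega
    · rintro r ⟨g, ⟨x, hx⟩, hgA, rfl⟩
      have h1 := finrank_range_mulLeft_add g
      have h2 : finrank F (translateOrthogonal (g.coeff : ZMod p → F)) ≤ d := by
        refine hmax ⟨g.coeff, fun h => ?_, fun y hy => hgA (by simpa using hy), rfl⟩
        exact (Finsupp.mem_support_iff.1 hx) (congrFun h x)
      omega
  rw [uncertaintyNumber, hleast.csInf_eq]
  omega

end Orthogonal

/-! ### From multiplication operators to cycles -/

section ToCycles

open Finset Module

variable {p : ℕ} [Fact p.Prime] {F : Type*} [Field F] {A : Finset (ZMod p)}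

lemma exists_det_ne_zero {k : ℕ} {α : Type*} [Fintype α] {h : Fin k → α → F}
    (hli : LinearIndependent F h) :
    ∃ v : Fin k → α, (Matrix.of fun i j => h i (v j)).det ≠ 0 := by
  let M : Matrix (Fin k) α F := Matrix.of h
  have hrank : finrank F (Submodule.span F (Set.range M.col)) = k := by
    rw [← Matrix.rank_eq_finrank_span_cols, LinearIndependent.rank_matrix (M := M) hli,
      Fintype.card_fin]
  obtain ⟨g, hg, -, hgli⟩ := Submodule.exists_fun_fin_finrank_span_eq F (Set.range M.col)
  choose v hv using hg
  refine ⟨v ∘ Fin.cast hrank.symm, ?_⟩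
  have h1 : LinearIndependent F
      (Matrix.of fun i j => h i ((v ∘ Fin.cast hrank.symm) j)).col := by
    have h2 : (Matrix.of fun i j => h i ((v ∘ Fin.cast hrank.symm) j)).col =
        g ∘ Fin.cast hrank.symm := by
      funext j
      rw [Function.comp_apply, ← hv]
      rfl
    rw [h2]
    exact hgli.comp _ (Fin.cast_injective hrank.symm)
  rw [Matrix.linearIndependent_cols_iff_isUnit, Matrix.isUnit_iff_isUnit_det] at h1
  exact h1.ne_zero

/-- If `h_1, …, h_k` are orthogonal to all translates of `f`, then `v ↦ f(∑ v_j) det(h_i(v_j))` is a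
cycle: the boundary is seen to vanish by expanding the determinant along its first column. -/
theorem exists_cycle_of_le_finrank {n : ℕ} (hn : n + 2 < p) {f : ZMod p → F} (hf : f ≠ 0)
    (hfA : ∀ x, f x ≠ 0 → x ∈ A) (hdim : n + 2 ≤ finrank F (translateOrthogonal f)) :
    ∃ φ ∈ cycles (sumComplex A (n + 2)) F (n + 1), φ ≠ 0 := by
  obtain ⟨g, hgli⟩ := exists_linearIndependent_of_le_finrank hdim
  have hgli' : LinearIndependent F fun i => (g i : ZMod p → F) :=
    hgli.map' (translateOrthogonal f).subtype (Submodule.ker_subtype _)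
  obtain ⟨u, hu⟩ := exists_det_ne_zero hgli'
  obtain ⟨a, ha⟩ := Function.ne_iff.1 hf
  -- As `n + 2` is invertible mod `p`, a translation moves the sum of the entries of `u` to `a`.
  have hn0 : ((n + 2 : ℕ) : ZMod p) ≠ 0 := by
    rw [Ne, ZMod.natCast_eq_zero_iff]
    exact Nat.not_dvd_of_pos_of_lt (by omega) hn
  let t : ZMod p := (a - ∑ i, u i) / ((n + 2 : ℕ) : ZMod p)
  let h : Fin (n + 2) → ZMod p → F := fun i x => (g i : ZMod p → F) (x - t)
  have hh : ∀ i, h i ∈ translateOrthogonal f := fun i =>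
    translate_mem_translateOrthogonal (g i).2 t
  refine ⟨fun v => f (∑ i, v i) * (Matrix.of fun i j => h i (v j)).det,
    mem_cycles_sumComplex_iff.2 ⟨fun σ v => ?_, fun v hv => ⟨fun i j hij => ?_, ?_⟩, fun w => ?_⟩,
    fun h0 => ?_⟩
  · have h1 : (Matrix.of fun i j => h i ((v ∘ σ) j)).det =
        ((Equiv.Perm.sign σ : ℤ) : F) * (Matrix.of fun i j => h i (v j)).det :=
      Matrix.det_permute' σ (Matrix.of fun i j => h i (v j))
    rw [h1, show ∑ i, (v ∘ σ) i = ∑ i, v i from Equiv.sum_comp σ v]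
    ring
  · by_contra hne
    exact right_ne_zero_of_mul hv (Matrix.det_zero_of_column_eq hne fun l => by simp [hij])
  · exact hfA _ (left_ne_zero_of_mul hv)
  · have hexp : ∀ x, (Matrix.of fun i j => h i ((Fin.cons x w : Fin (n + 2) → ZMod p) j)).det =
        ∑ i : Fin (n + 2), (-1) ^ (i : ℕ) * h i x *
          (Matrix.of fun (l j : Fin (n + 1)) => h (i.succAbove l) (w j)).det := by
      intro x
      rw [Matrix.det_succ_column_zero]
      rfl
    simp only [hexp, Fin.sum_univ_succ (fun i => (Fin.cons _ w : Fin (n + 2) → ZMod p) i),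
      Fin.cons_zero, Fin.cons_succ, mul_sum]
    rw [sum_comm]
    refine sum_eq_zero fun i _ => ?_
    have h1 := hh i (∑ j, w j)
    calc _ = ∑ x, f (x + ∑ j, w j) * h i x * ((-1) ^ (i : ℕ) *
          (Matrix.of fun (l j : Fin (n + 1)) => h (i.succAbove l) (w j)).det) :=
          sum_congr rfl fun x _ => by ring
      _ = 0 := by rw [← sum_mul, h1, zero_mul]
  · have h1 := congrFun h0 fun i => u i + t
    simp only [h, add_sub_cancel_right, sum_add_distrib, sum_const, card_univ, Fintype.card_fin,
      nsmul_eq_mul, Pi.zero_apply, mul_eq_zero] at h1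
    refine h1.elim (fun h2 => ha ?_) hu
    rw [Pi.zero_apply, ← h2]
    congr 1
    simp only [t]
    rw [mul_div_cancel₀ _ hn0]
    ring

end ToCycles

/-! ### From cycles to multiplication operators -/

section FromCycles

open Finset Module

variable {p : ℕ} [Fact p.Prime] {F : Type*} [Field F] {A : Finset (ZMod p)}

/-- A cycle pairs to zero with every function that does not depend on the `i`-th vertex. -/
lemma sum_mul_eq_zero_of_mem_cycles {n : ℕ} {φ : (Fin (n + 2) → ZMod p) → F}
    (hφ : φ ∈ cycles (sumComplex A (n + 2)) F (n + 1)) (i : Fin (n + 2))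
    {g : (Fin (n + 2) → ZMod p) → F} (hg : ∀ v w, (∀ j, j ≠ i → v j = w j) → g v = g w) :
    ∑ v, φ v * g v = 0 := by
  obtain ⟨hperm, -, hcyc⟩ := mem_cycles_sumComplex_iff.1 hφ
  rw [← Equiv.sum_comp ((Equiv.swap 0 i).arrowCongr (Equiv.refl (ZMod p))),
    ← Equiv.sum_comp (Fin.consEquiv fun _ => ZMod p), Fintype.sum_prod_type_right]
  refine sum_eq_zero fun w _ => ?_
  have h1 : ∀ x : ZMod p, ((Equiv.swap 0 i).arrowCongr (Equiv.refl (ZMod p)))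
      (Fin.consEquiv (fun _ => ZMod p) (x, w)) =
      (Fin.cons x w : Fin (n + 2) → ZMod p) ∘ Equiv.swap 0 i := by
    intro x
    funext l
    simp [Equiv.arrowCongr, Fin.consEquiv]
  have h2 : ∀ x : ZMod p, g ((Fin.cons x w : Fin (n + 2) → ZMod p) ∘ Equiv.swap 0 i) =
      g ((Fin.cons 0 w : Fin (n + 2) → ZMod p) ∘ Equiv.swap 0 i) := by
    intro x
    refine hg _ _ fun j hj => ?_
    obtain ⟨l, hl⟩ := Fin.exists_succ_eq.2 (show Equiv.swap 0 i j ≠ 0 by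
      rw [Ne, Equiv.swap_apply_eq_iff, Equiv.swap_apply_left]
      exact hj)
    simp [← hl]
  simp only [h1, h2, hperm, mul_assoc]
  rw [← mul_sum, ← sum_mul, hcyc, zero_mul, mul_zero]

/-- Alternation, without division by two: the terms of the sum cancel in pairs. -/
lemma sum_mul_eq_zero_of_swap {n : ℕ} {φ : (Fin (n + 2) → ZMod p) → F}
    (hφ : φ ∈ cycles (sumComplex A (n + 2)) F (n + 1)) {i j : Fin (n + 2)} (hij : i ≠ j)
    {g : (Fin (n + 2) → ZMod p) → F} (hg : ∀ v, g (v ∘ Equiv.swap i j) = g v) :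
    ∑ v, φ v * g v = 0 := by
  obtain ⟨hperm, hsupp, -⟩ := mem_cycles_sumComplex_iff.1 hφ
  refine sum_involution (fun v _ => v ∘ Equiv.swap i j) (fun v _ => ?_) (fun v _ hv h => ?_)
    (fun _ _ => mem_univ _) (fun v _ => ?_)
  · rw [hperm, Equiv.Perm.sign_swap hij, hg]
    simp
  · have h1 := congrFun h i
    rw [Function.comp_apply, Equiv.swap_apply_left] at h1
    exact hij.symm ((hsupp v (left_ne_zero_of_mul hv)).1 h1)
  · funext l
    simp

lemma addChar_map_sum {ι B : Type*} [AddCommMonoid B] (ψ : AddChar B F) (s : Finset ι)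
    (f : ι → B) : ψ (∑ i ∈ s, f i) = ∏ i ∈ s, ψ (f i) := by
  classical
  induction s using Finset.induction_on with
  | empty => simp
  | insert a s ha ih => rw [sum_insert ha, prod_insert ha, AddChar.map_add_eq_mul, ih]

lemma exists_isPrimitive_addChar [IsAlgClosed F] (hp : (p : F) ≠ 0) :
    ∃ ψ : AddChar (ZMod p) F, ψ.IsPrimitive := by
  have : NeZero (p : F) := ⟨hp⟩
  obtain ⟨ζ, hζ⟩ := HasEnoughRootsOfUnity.exists_primitiveRoot F p
  exact ⟨_, AddChar.zmodChar_primitive_of_primitive_root p hζ⟩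

lemma linearIndependent_addChar_mul {ψ : AddChar (ZMod p) F} (hψ : ψ.IsPrimitive)
    (hp : (p : F) ≠ 0) : LinearIndependent F fun (t : ZMod p) (x : ZMod p) => ψ (t * x) := by
  rw [Fintype.linearIndependent_iff]
  intro c hc s
  have h1 : ∑ x, ψ (-s * x) * (∑ t, c t • fun x : ZMod p => ψ (t * x)) x = 0 := by
    simp only [hc, Pi.zero_apply, mul_zero, sum_const_zero]
  have h2 : ∀ t, ∑ x : ZMod p, ψ (-s * x) * (c t * ψ (t * x)) = if t = s then c t * p else 0 := by
    intro t
    have h3 := AddChar.sum_mulShift (t - s) hψ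
    rw [ZMod.card] at h3
    calc _ = ∑ x : ZMod p, c t * ψ (x * (t - s)) := sum_congr rfl fun x _ => by
          rw [mul_left_comm, ← AddChar.map_add_eq_mul]
          congr 2
          ring
      _ = _ := by
          rw [← mul_sum, h3]
          simp only [sub_eq_zero]
          split_ifs <;> simp
  simp only [Finset.sum_apply, Pi.smul_apply, smul_eq_mul, mul_sum] at h1
  rw [sum_comm, sum_congr rfl fun t _ => h2 t] at h1
  simpa [hp] using h1

/-- Fourier transform of a cycle. If it does not vanish at `b`, then its restriction to the
translates `b + t (1, …, 1)` is the Fourier transform of a function supported in `A`, and it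
vanishes at the distinct points `t = -b_i`. -/
theorem exists_le_finrank_of_mem_cycles_of_addChar {ψ : AddChar (ZMod p) F} (hψ : ψ.IsPrimitive)
    (hp : (p : F) ≠ 0) {n : ℕ} {φ : (Fin (n + 2) → ZMod p) → F}
    (hφ : φ ∈ cycles (sumComplex A (n + 2)) F (n + 1)) (hφ0 : φ ≠ 0) :
    ∃ f : ZMod p → F, f ≠ 0 ∧ (∀ x, f x ≠ 0 → x ∈ A) ∧
      n + 2 ≤ finrank F (translateOrthogonal f) := by
  obtain ⟨b, hb⟩ : ∃ b : Fin (n + 2) → ZMod p, ∑ v, φ v * ∏ i, ψ (b i * v i) ≠ 0 := by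
    by_contra! hall
    refine hφ0 (funext fun u => ?_)
    have h1 : ∑ b : Fin (n + 2) → ZMod p, (∏ i, ψ (-(b i * u i))) *
        ∑ v, φ v * ∏ i, ψ (b i * v i) = 0 := by simp [hall]
    have h2 : ∀ v : Fin (n + 2) → ZMod p, ∑ b : Fin (n + 2) → ZMod p,
        ∏ i, ψ (b i * (v i - u i)) = if v = u then (p : F) ^ (n + 2) else 0 := by
      intro v
      rw [← Fintype.piFinset_univ, sum_prod_piFinset univ fun i x => ψ (x * (v i - u i))]
      simp only [AddChar.sum_mulShift _ hψ, ZMod.card, sub_eq_zero]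
      split_ifs with h
      · simp [h]
      · obtain ⟨i, hi⟩ := Function.ne_iff.1 h
        exact prod_eq_zero (mem_univ i) (by simp [hi])
    have h3 : ∑ b : Fin (n + 2) → ZMod p, (∏ i, ψ (-(b i * u i))) *
        ∑ v, φ v * ∏ i, ψ (b i * v i) =
        ∑ v, φ v * ∑ b : Fin (n + 2) → ZMod p, ∏ i, ψ (b i * (v i - u i)) := by
      simp only [mul_sum]
      rw [sum_comm]
      refine sum_congr rfl fun v _ => sum_congr rfl fun b _ => ?_
      rw [mul_left_comm, ← prod_mul_distrib]
      congr 1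
      refine prod_congr rfl fun i _ => ?_
      rw [← AddChar.map_add_eq_mul]
      congr 1
      ring
    rw [h3] at h1
    simpa [h2, hp] using h1
  have hbinj : Function.Injective b := by
    intro i j hij
    by_contra hne
    refine hb (sum_mul_eq_zero_of_swap hφ hne fun v => ?_)
    rw [← Equiv.prod_comp (Equiv.swap i j)]
    refine prod_congr rfl fun l _ => ?_
    have h1 : b (Equiv.swap i j l) = b l := by
      rcases eq_or_ne l i with rfl | hi
      · simp [hij]
      rcases eq_or_ne l j with rfl | hj
      · simp [hij]
      · rw [Equiv.swap_apply_of_ne_of_ne hi hj]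
    rw [h1]
    simp
  let f : ZMod p → F := fun a => ∑ v with ∑ i, v i = a, φ v * ∏ i, ψ (b i * v i)
  have hf : ∀ t, ∑ a, f a * ψ (t * a) = ∑ v, φ v * ∏ i, ψ ((b i + t) * v i) := by
    intro t
    rw [← sum_fiberwise univ fun v : Fin (n + 2) → ZMod p => ∑ i, v i]
    refine sum_congr rfl fun a _ => ?_
    rw [sum_mul]
    refine sum_congr rfl fun v hv => ?_
    rw [← (mem_filter.1 hv).2, mul_sum, addChar_map_sum, mul_assoc, ← prod_mul_distrib]
    congr 1
    refine prod_congr rfl fun i _ => ?_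
    rw [add_mul, AddChar.map_add_eq_mul]
  refine ⟨f, fun h0 => hb ?_, fun a ha => ?_,
    le_finrank_translateOrthogonal (h := fun i x => ψ (-b i * x)) ?_ fun i s => ?_⟩
  · have h1 := hf 0
    rw [h0] at h1
    simpa using h1.symm
  · obtain ⟨v, hv, hne⟩ := exists_ne_zero_of_sum_ne_zero ha
    rw [← (mem_filter.1 hv).2]
    exact ((mem_cycles_sumComplex_iff.1 hφ).2.1 v (left_ne_zero_of_mul hne)).2
  · exact (linearIndependent_addChar_mul hψ hp).comp (fun i => -b i) (neg_injective.comp hbinj)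
  · have h1 : ∑ x, f (x + s) * ψ (-b i * x) = ψ (b i * s) * ∑ a, f a * ψ (-b i * a) := by
      rw [← Equiv.sum_comp (Equiv.addRight s) fun a => f a * ψ (-b i * a), mul_sum]
      refine sum_congr rfl fun x _ => ?_
      rw [mul_left_comm, ← AddChar.map_add_eq_mul, Equiv.coe_addRight]
      congr 2
      ring
    rw [h1, hf, sum_mul_eq_zero_of_mem_cycles hφ i, mul_zero]
    intro v w hvw
    refine prod_congr rfl fun j _ => ?_
    rcases eq_or_ne j i with rfl | hj
    · simp
    · rw [hvw j hj]

/-- Fewer than `|A|` linear conditions leave a nonzero function supported in `A`. -/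
lemma exists_le_finrank_of_lt_card {k : ℕ} {h : Fin k → ZMod p → F} (hli : LinearIndependent F h)
    (htrans : ∀ i s, ∃ c : Fin k → F, ∀ x, h i (x - s) = ∑ j, c j * h j x) (hk : k < A.card) :
    ∃ f : ZMod p → F, f ≠ 0 ∧ (∀ x, f x ≠ 0 → x ∈ A) ∧
      k ≤ finrank F (translateOrthogonal f) := by
  let T : (A → F) →ₗ[F] (Fin k → F) :=
    { toFun := fun g i => ∑ a : A, g a * h i a
      map_add' := fun g g' => by
        funext i
        simp [add_mul, sum_add_distrib]
      map_smul' := fun c g => by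
        funext i
        simp [mul_sum, mul_assoc] }
  have hker : LinearMap.ker T ≠ ⊥ := LinearMap.ker_ne_bot_of_finrank_lt (by simpa using hk)
  obtain ⟨g, hg, hg0⟩ := Submodule.exists_mem_ne_zero_of_ne_bot hker
  let f : ZMod p → F := fun x => if hx : x ∈ A then g ⟨x, hx⟩ else 0
  have hf : ∀ i, ∑ x, f x * h i x = 0 := by
    intro i
    have h1 : ∑ a : A, g a * h i a = 0 := congrFun (LinearMap.mem_ker.1 hg) i
    rw [← h1, ← sum_subset (subset_univ A) fun x _ hx => by simp [f, hx], ← sum_coe_sort A]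
    exact sum_congr rfl fun a _ => by simp [f]
  refine ⟨f, fun h0 => hg0 (funext fun a => ?_), fun x hx => ?_,
    le_finrank_translateOrthogonal hli fun i s => ?_⟩
  · simpa [f] using congrFun h0 a
  · by_contra hxA
    exact hx (by simp [f, hxA])
  · obtain ⟨c, hc⟩ := htrans i s
    rw [← Equiv.sum_comp (Equiv.subRight s)]
    simp only [Equiv.subRight_apply, sub_add_cancel, hc, mul_sum]
    rw [sum_comm]
    refine sum_eq_zero fun j _ => ?_
    calc _ = c j * ∑ x, f x * h j x := by
          rw [mul_sum]
          exact sum_congr rfl fun x _ => by ring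
      _ = 0 := by rw [hf, mul_zero]

lemma exists_translation_family_of_ringHom (c : ZMod p →+* F) {k : ℕ} (hk : k ≤ p) :
    ∃ h : Fin k → ZMod p → F, LinearIndependent F h ∧
      ∀ i s, ∃ c : Fin k → F, ∀ x, h i (x - s) = ∑ j, c j * h j x := by
  refine ⟨fun i x => c x ^ (i : ℕ), ?_, fun i s =>
    ⟨fun j => (-c s) ^ ((i : ℕ) - j) * ((i : ℕ).choose j), fun x => ?_⟩⟩
  · rw [Fintype.linearIndependent_iff]
    intro a ha i
    let P : Polynomial F := ∑ j : Fin k, Polynomial.monomial (j : ℕ) (a j)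
    have hP : P = 0 := by
      refine Polynomial.eq_zero_of_natDegree_lt_card_of_eval_eq_zero P c.injective (fun x => ?_) ?_
      · have h1 := congrFun ha x
        simpa [P, Polynomial.eval_finsetSum] using h1
      · rw [ZMod.card]
        have h1 : P.natDegree ≤ k - 1 := by
          refine Polynomial.natDegree_sum_le_of_forall_le _ _ fun j _ => ?_
          exact (Polynomial.natDegree_monomial_le _).trans (by omega)
        have := i.2
        omega
    have h1 := congrArg (fun Q => Polynomial.coeff Q i) hP
    simpa [P, Polynomial.finsetSum_coeff, Polynomial.coeff_monomial, Fin.val_inj] using h1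
  · beta_reduce
    rw [map_sub, sub_eq_add_neg, add_pow,
      Fin.sum_univ_eq_sum_range (fun j => (-c s) ^ ((i : ℕ) - j) * ((i : ℕ).choose j) * c x ^ j)]
    rw [← sum_subset (range_subset_range.2 i.2)]
    · exact sum_congr rfl fun j _ => by ring
    · intro j _ hj
      rw [Nat.choose_eq_zero_of_lt (by simpa using hj)]
      simp

lemma exists_translation_family_of_addChar {ψ : AddChar (ZMod p) F} (hψ : ψ.IsPrimitive)
    (hp : (p : F) ≠ 0) {k : ℕ} (hk : k ≤ p) :
    ∃ h : Fin k → ZMod p → F, LinearIndependent F h ∧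
      ∀ i s, ∃ c : Fin k → F, ∀ x, h i (x - s) = ∑ j, c j * h j x := by
  refine ⟨fun i x => ψ (((i : ℕ) : ZMod p) * x),
    (linearIndependent_addChar_mul hψ hp).comp (fun i : Fin k => ((i : ℕ) : ZMod p)) ?_,
    fun i s => ⟨Pi.single i (ψ (-((i : ℕ) : ZMod p) * s)), fun x => ?_⟩⟩
  · intro i j hij
    have h1 := (ZMod.natCast_eq_natCast_iff' _ _ _).1 hij
    rw [Nat.mod_eq_of_lt (i.2.trans_le hk), Nat.mod_eq_of_lt (j.2.trans_le hk)] at h1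
    exact Fin.ext h1
  · simp only [Pi.single_apply, ite_mul, zero_mul, sum_ite_eq', mem_univ, if_true]
    rw [← AddChar.map_add_eq_mul]
    congr 1
    ring

variable [IsAlgClosed F]

variable (F) in
/-- Either `F` has characteristic `p`, or it has a primitive character of `ZMod p`. -/
lemma nonempty_ringHom_or_exists_addChar :
    Nonempty (ZMod p →+* F) ∨ (p : F) ≠ 0 ∧ ∃ ψ : AddChar (ZMod p) F, ψ.IsPrimitive := by
  by_cases hp : (p : F) = 0
  · have : CharP F p := ringChar.of_eq (CharP.ringChar_of_prime_eq_zero Fact.out hp)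
    exact Or.inl ⟨ZMod.castHom dvd_rfl F⟩
  · exact Or.inr ⟨hp, exists_isPrimitive_addChar hp⟩

variable (F) in
theorem exists_le_finrank {k : ℕ} (hk : k < A.card) :
    ∃ f : ZMod p → F, f ≠ 0 ∧ (∀ x, f x ≠ 0 → x ∈ A) ∧
      k ≤ finrank F (translateOrthogonal f) := by
  have hkp : k ≤ p := (hk.trans_le (card_le_univ A)).le.trans_eq (ZMod.card p)
  rcases nonempty_ringHom_or_exists_addChar F (p := p) with ⟨⟨c⟩⟩ | ⟨hp, ψ, hψ⟩
  · obtain ⟨h, hli, htrans⟩ := exists_translation_family_of_ringHom c hkp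
    exact exists_le_finrank_of_lt_card hli htrans hk
  · obtain ⟨h, hli, htrans⟩ := exists_translation_family_of_addChar hψ hp hkp
    exact exists_le_finrank_of_lt_card hli htrans hk

theorem exists_le_finrank_of_mem_cycles {n : ℕ} (hn : n + 2 < p) {φ : (Fin (n + 2) → ZMod p) → F}
    (hφ : φ ∈ cycles (sumComplex A (n + 2)) F (n + 1)) (hφ0 : φ ≠ 0) :
    ∃ f : ZMod p → F, f ≠ 0 ∧ (∀ x, f x ≠ 0 → x ∈ A) ∧
      n + 2 ≤ finrank F (translateOrthogonal f) := by
  rcases nonempty_ringHom_or_exists_addChar F (p := p) with ⟨⟨c⟩⟩ | ⟨hp, ψ, hψ⟩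
  · refine exists_le_finrank F (lt_of_not_ge fun hA => hφ0 ?_)
    exact eq_zero_of_mem_cycles_of_ringHom c hn hA hφ
  · exact exists_le_finrank_of_mem_cycles_of_addChar hψ hp hφ hφ0

/-- In positive dimensions the homology of the sum complex detects the kernels of multiplication
operators. -/
theorem nontrivial_homology_iff_exists_le_finrank {k : ℕ} (hk1 : 1 < k) (hkp : k < p) :
    Nontrivial (Homology (sumComplex A k) F (k - 1)) ↔
      ∃ f : ZMod p → F, f ≠ 0 ∧ (∀ x, f x ≠ 0 → x ∈ A) ∧
        k ≤ finrank F (translateOrthogonal f) := by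
  obtain ⟨n, rfl⟩ := Nat.exists_eq_add_of_le' hk1
  change Nontrivial (Homology (sumComplex A (n + 1 + 1)) F (n + 1)) ↔ _
  rw [nontrivial_homology_iff]
  constructor
  · rintro ⟨φ, hφ, hφ0⟩
    exact exists_le_finrank_of_mem_cycles hkp hφ hφ0
  · rintro ⟨f, hf, hfA, hdim⟩
    exact exists_cycle_of_le_finrank hkp hf hfA hdim

end FromCycles

/-! ### Homology and uncertainty -/

section Uncertainty

open Finset Module

variable {p : ℕ} [Fact p.Prime] {F : Type*} [Field F] {A : Finset (ZMod p)}

/-- Every `0`-chain is an unreduced cycle. -/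
lemma nontrivial_homology_zero (hA : A.Nonempty) :
    Nontrivial (Homology (sumComplex A 1) F 0) := by
  obtain ⟨a, ha⟩ := hA
  rw [nontrivial_homology_iff]
  refine ⟨Pi.single (fun _ => a) 1, ⟨fun σ v => ?_, fun v hv => ⟨?_, ?_⟩⟩, by simp⟩
  · have : Subsingleton (Fin (0 + 1)) := inferInstanceAs (Subsingleton (Fin 1))
    rw [Subsingleton.elim σ 1]
    simp
  · have : Subsingleton (Fin (0 + 1)) := inferInstanceAs (Subsingleton (Fin 1))
    exact Function.injective_of_subsingleton v
  · have h1 : v = fun _ => a := by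
      by_contra h
      exact hv (Pi.single_eq_of_ne h _)
    subst h1
    refine ⟨by simp, Or.inr ?_⟩
    simpa using ha

lemma finrank_translateOrthogonal_eq_zero {f : ZMod p → F} (hf : f ≠ 0) {a : ZMod p}
    (hfa : ∀ x, f x ≠ 0 → x = a) : finrank F (translateOrthogonal f) = 0 := by
  have hz : ∀ x, x ≠ a → f x = 0 := fun x hx => by
    by_contra h
    exact hx (hfa x h)
  have ha : f a ≠ 0 := by
    obtain ⟨x, hx⟩ := Function.ne_iff.1 hf
    exact hfa x hx ▸ hx
  rw [(Submodule.eq_bot_iff (translateOrthogonal f)).2, finrank_bot]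
  intro h hh
  funext y
  have h1 := hh (a - y)
  rw [sum_eq_single y] at h1
  · simpa [ha] using h1
  · intro x _ hx
    rw [hz _ fun h2 => hx (by linear_combination h2), zero_mul]
  · simp

variable (F) in
lemma exists_isGreatest_finrank (hA : A.Nonempty) :
    ∃ d, IsGreatest {d | ∃ f : ZMod p → F, f ≠ 0 ∧ (∀ x, f x ≠ 0 → x ∈ A) ∧
      d = finrank F (translateOrthogonal f)} d := by
  obtain ⟨a, ha⟩ := hA
  have hbdd : BddAbove {d | ∃ f : ZMod p → F, f ≠ 0 ∧ (∀ x, f x ≠ 0 → x ∈ A) ∧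
      d = finrank F (translateOrthogonal f)} := by
    refine ⟨p, ?_⟩
    rintro _ ⟨f, hf, -, rfl⟩
    exact (finrank_translateOrthogonal_lt hf).le
  refine ⟨_, Nat.sSup_mem ⟨_, Pi.single a 1, by simp, fun x hx => ?_, rfl⟩ hbdd,
    fun d hd => le_csSup hbdd hd⟩
  have : x = a := by
    by_contra h
    exact hx (Pi.single_eq_of_ne h _)
  exact this ▸ ha

end Uncertainty

end SumComplex

end

theorem theorem1p3 (p : ℕ) [Fact p.Prime] (F : Type*) [Field F] [IsAlgClosed F]
    (A : Finset (ZMod p)) :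
    (3 ≤ A.card →
      ∃ k : ℕ,
        IsGreatest {k : ℕ | 1 < k ∧ k < p ∧
          Nontrivial (SumComplex.Homology (SumComplex.sumComplex A k) F (k - 1))} k ∧
        (SumComplex.uncertaintyNumber F A : ℤ) = (p : ℤ) - k) ∧
    (2 ≤ A.card →
      ∃ k : ℕ,
        IsGreatest {k : ℕ | 1 ≤ k ∧ k < p ∧
          Nontrivial (SumComplex.Homology (SumComplex.sumComplex A k) F (k - 1))} k ∧
        (SumComplex.uncertaintyNumber F A : ℤ) = (p : ℤ) - k) ∧
    (A.card = 1 →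
      (∀ k : ℕ, 1 < k → k < p →
        ¬ Nontrivial (SumComplex.Homology (SumComplex.sumComplex A k) F (k - 1))) ∧
      SumComplex.uncertaintyNumber F A = p) := by
  rcases A.eq_empty_or_nonempty with rfl | hA
  · simp
  obtain ⟨d, hd⟩ := SumComplex.exists_isGreatest_finrank F hA
  have hu := SumComplex.uncertaintyNumber_add_eq hd
  obtain ⟨⟨f, hf, hfA, hfd⟩, hmax⟩ := hd
  have hdp : d < p := hfd ▸ SumComplex.finrank_translateOrthogonal_lt hf
  have hle : ∀ k, 1 < k → k < p →
      Nontrivial (SumComplex.Homology (SumComplex.sumComplex A k) F (k - 1)) → k ≤ d := by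
    intro k hk1 hkp hk
    obtain ⟨g, hg, hgA, hgk⟩ :=
      (SumComplex.nontrivial_homology_iff_exists_le_finrank hk1 hkp).1 hk
    exact hgk.trans (hmax ⟨g, hg, hgA, rfl⟩)
  have hd_mem : 1 < d →
      Nontrivial (SumComplex.Homology (SumComplex.sumComplex A d) F (d - 1)) := fun h1 =>
    (SumComplex.nontrivial_homology_iff_exists_le_finrank h1 hdp).2 ⟨f, hf, hfA, hfd.le⟩
  have hcard : A.card ≤ d + 1 := by
    obtain ⟨g, hg, hgA, hgk⟩ := SumComplex.exists_le_finrank F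
      (show A.card - 1 < A.card from Nat.sub_lt hA.card_pos one_pos)
    have := hgk.trans (hmax ⟨g, hg, hgA, rfl⟩)
    omega
  refine ⟨fun h3 => ⟨d, ⟨⟨by omega, hdp, hd_mem (by omega)⟩, fun k hk => hle k hk.1 hk.2.1 hk.2.2⟩,
    by omega⟩, fun h2 => ⟨d, ⟨⟨by omega, hdp, ?_⟩, fun k hk => ?_⟩, by omega⟩, fun h1 => ?_⟩
  · rcases (show 1 ≤ d by omega).eq_or_lt with rfl | h1
    · exact SumComplex.nontrivial_homology_zero hA
    · exact hd_mem h1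
  · rcases hk.1.eq_or_lt with rfl | h1
    · omega
    · exact hle k h1 hk.2.1 hk.2.2
  · obtain ⟨a, rfl⟩ := Finset.card_eq_one.1 h1
    have hd0 : d = 0 := hfd.trans (SumComplex.finrank_translateOrthogonal_eq_zero hf (a := a)
      fun x hx => Finset.mem_singleton.1 (hfA x hx))
    exact ⟨fun k hk1 hkp hk => by have := hle k hk1 hkp hk; omega, by omega⟩
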